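/- Let $k$ be a field and let $H$ be a finite-dimensional Hopf algebra over $k$, with comultiplication $\Delta$, counit $\varepsilon$ and antipode $S$. Put $\Delta^{(1)}=\mathrm{id}_H$ and $\Delta^{(n+1)}=(\mathrm{id}\otimes\Delta^{(n)})\circ\Delta$ for $n\ge 1$, and let $m^{(n)}:H^{\otimes n}\to H$ be the multiplication map. Let $P_0(h)=\varepsilon(h)1$ and $P_n=m^{(n)}\circ\Delta^{(n)}$ for $n\ge 1$ be the Sweedler power maps, and for $n\ge 1$ let $\nu_n(H)=\operatorname{Tr}(S\circ P_{n-1})\in k$ be the $n$-th indicator of $H$. A sequence $(a_n)_{n\ge 1}$ in $k$ satisfies a polynomial $f=f_0+f_1x+\dots+f_mx^m\in k[x]$ if $f_0a_n+f_1a_{n+1}+\dots+f_ma_{n+m}=0$ for all $n\ge 1$. It is linearly recursive if it satisfies some nonzero polynomial, and then its minimal polynomial is the unique monic polynomial of least degree that it satisfies. A 2-cocycle of $H$ is an invertible element $F\in H\otimes H$ with $(\varepsilon\otimes\mathrm{id})(F)=(\mathrm{id}\otimes\varepsilon)(F)=1$ and $(1\otimes F)\,(\mathrm{id}\otimes\Delta)(F)\,(\Delta\otimes\mathrm{id})(F^{-1})\,(F^{-1}\otimes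 1)=1\otimes 1\otimes 1$. The twist $H^F$ is the algebra $H$ with the counit $\varepsilon$ and the comultiplication $\Delta_F(h)=F\Delta(h)F^{-1}$. A Hopf algebra $H'$ over $k$ is gauge equivalent to $H$ if $H'$ is isomorphic, as a bialgebra, to $H^F$ for some 2-cocycle $F$ of $H$. **Proposition.** The sequence $(\nu_n(H))_{n\ge 1}$ is linearly recursive, and its minimal polynomial $p_H$ has degree at most $(\dim_k H)^2$. Moreover, $p_H$ is a gauge invariant: if $H'$ is a Hopf algebra over $k$ that is gauge equivalent to $H$, then $p_{H'}=p_H$. -/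

import Mathlib

open scoped TensorProduct

universe u v w

noncomputable section

namespace LinRec

open Polynomial

variable {k : Type*} [Field k]

/-- The sequence `a` satisfies the polynomial `f = ∑ i, f_i x ^ i` when
`∑ i, f_i * a (n + i) = 0` for all `n`. -/
def Satisfies (a : ℕ → k) (f : k[X]) : Prop :=
  ∀ n : ℕ, f.sum (fun i c => c * a (n + i)) = 0

/-- A sequence is linearly recursive if it satisfies a non-zero polynomial. -/
def IsLinearlyRecursive (a : ℕ → k) : Prop :=
  ∃ f : k[X], f ≠ 0 ∧ Satisfies a f

/-- `p` is a monic polynomial of least degree satisfied by `a`. -/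
def IsMinimalPolynomial (a : ℕ → k) (p : k[X]) : Prop :=
  p.Monic ∧ Satisfies a p ∧ ∀ q : k[X], q.Monic → Satisfies a q → p.natDegree ≤ q.natDegree

theorem Satisfies.smul {a : ℕ → k} {f : k[X]} (hf : Satisfies a f) (c : k) :
    Satisfies a (C c * f) := by
  intro n
  have h := hf n
  rw [← smul_eq_C_mul, sum_smul_index _ _ _ (by simp)]
  simp only [mul_assoc]
  simp only [Polynomial.sum] at h ⊢
  rw [← Finset.mul_sum, h, mul_zero]

theorem Satisfies.sub {a : ℕ → k} {f g : k[X]} (hf : Satisfies a f) (hg : Satisfies a g) :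
    Satisfies a (f - g) := by
  intro n
  have h := (hg.smul (-1)) n
  have e : f - g = f + C (-1) * g := by simp [sub_eq_add_neg]
  rw [e, sum_add_index _ _ _ (by simp) (by intros; ring), hf n, h, add_zero]

theorem exists_monic_satisfies {a : ℕ → k} {f : k[X]} (h0 : f ≠ 0) (hf : Satisfies a f) :
    ∃ g : k[X], g.Monic ∧ Satisfies a g ∧ g.natDegree = f.natDegree :=
  ⟨C f.leadingCoeff⁻¹ * f, by
    rw [mul_comm]; exact monic_mul_leadingCoeff_inv h0, hf.smul _,
    natDegree_C_mul (inv_ne_zero (leadingCoeff_ne_zero.mpr h0))⟩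

/-- A linearly recursive sequence has exactly one minimal polynomial. -/
theorem existsUnique_isMinimalPolynomial {a : ℕ → k} (h : IsLinearlyRecursive a) :
    ∃! p : k[X], IsMinimalPolynomial a p := by
  classical
  obtain ⟨f, h0, hf⟩ := h
  obtain ⟨g, hgm, hgs, -⟩ := exists_monic_satisfies h0 hf
  have hex : ∃ d : ℕ, ∃ q : k[X], q.Monic ∧ Satisfies a q ∧ q.natDegree = d :=
    ⟨_, g, hgm, hgs, rfl⟩
  obtain ⟨p, hpm, hps, hpd⟩ := Nat.find_spec hex
  have hp : IsMinimalPolynomial a p :=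
    ⟨hpm, hps, fun q hq hqs => hpd ▸ Nat.find_min' hex ⟨q, hq, hqs, rfl⟩⟩
  refine ⟨p, hp, fun q hq => ?_⟩
  by_contra hne
  have hdeg : q.natDegree = p.natDegree :=
    le_antisymm (hq.2.2 p hp.1 hp.2.1) (hp.2.2 q hq.1 hq.2.1)
  have hsub : q - p ≠ 0 := sub_ne_zero.mpr hne
  obtain ⟨r, hrm, hrs, hrd⟩ := exists_monic_satisfies hsub (hq.2.1.sub hp.2.1)
  have h1 := hp.2.2 r hrm hrs
  have h2 : (q - p).degree < q.degree :=
    degree_sub_lt_left (by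
      rw [degree_eq_natDegree hq.1.ne_zero, degree_eq_natDegree hp.1.ne_zero, hdeg])
      hq.1.ne_zero (by rw [hq.1.leadingCoeff, hp.1.leadingCoeff])
  have h3 := natDegree_lt_natDegree hsub h2
  omega

open Classical in
/-- The minimal polynomial of a linearly recursive sequence
(and `0` for a sequence that is not linearly recursive). -/
def minimalPolynomial (a : ℕ → k) : k[X] :=
  if h : IsLinearlyRecursive a then (existsUnique_isMinimalPolynomial h).choose else 0

theorem isMinimalPolynomial_minimalPolynomial {a : ℕ → k} (h : IsLinearlyRecursive a) :
    IsMinimalPolynomial a (minimalPolynomial a) := by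
  rw [minimalPolynomial, dif_pos h]
  exact (existsUnique_isMinimalPolynomial h).choose_spec.1

end LinRec

namespace HopfIndicator

variable (k : Type*) [Field k] (H : Type*) [Ring H]

section Algebra

variable [Algebra k H]

/-- The map `H ⊗ H^{⊗ n} → H^{⊗ (n+1)}`, `x ⊗ (y₁ ⊗ ⋯ ⊗ yₙ) ↦ x ⊗ y₁ ⊗ ⋯ ⊗ yₙ`. -/
def tensorCons (n : ℕ) : H ⊗[k] (⨂[k]^n H) →ₗ[k] ⨂[k]^(n + 1) H :=
  TensorProduct.lift
    ((PiTensorProduct.lift (R := k) (s := fun _ : Fin n => H)).toLinearMap ∘ₗ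
      (PiTensorProduct.tprod k (s := fun _ : Fin (n + 1) => H)).curryLeft)

/-- The multiplication map `m^{(n)} : H^{⊗ n} → H`, `x₁ ⊗ ⋯ ⊗ xₙ ↦ x₁ ⋯ xₙ`. -/
def iterMul (n : ℕ) : (⨂[k]^n H) →ₗ[k] H :=
  PiTensorProduct.lift (MultilinearMap.mkPiAlgebraFin k n H)

end Algebra

section Bialgebra

variable [Bialgebra k H]

/-- The iterated comultiplication: `iterComul k H n` is `Δ^{(n+1)} : H → H^{⊗ (n+1)}`, where
`Δ^{(1)} = id` and `Δ^{(n+1)} = (id ⊗ Δ^{(n)}) ∘ Δ`. -/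
def iterComul : (n : ℕ) → H →ₗ[k] ⨂[k]^(n + 1) H
  | 0 => (PiTensorProduct.subsingletonEquiv (R := k) (s := fun _ : Fin 1 => H) 0).symm.toLinearMap
  | n + 1 => tensorCons k H (n + 1) ∘ₗ (iterComul n).lTensor H ∘ₗ Coalgebra.comul

/-- The Sweedler power map `P_n`: `P_0(h) = ε(h) 1`, and `P_n = m^{(n)} ∘ Δ^{(n)}` for `n ≥ 1`. -/
def sweedlerPower : ℕ → H →ₗ[k] H
  | 0 => Algebra.linearMap k H ∘ₗ Coalgebra.counit
  | n + 1 => iterMul k H (n + 1) ∘ₗ iterComul k H n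

end Bialgebra

/-- The `n`-th indicator `ν_n(H) = Tr(S ∘ P_{n-1})`, for `n ≥ 1` (the value at `n = 0` is
never used). -/
def indicator [HopfAlgebra k H] (n : ℕ) : k :=
  LinearMap.trace k H (HopfAlgebra.antipode k ∘ₗ sweedlerPower k H (n - 1))

/-- The sequence `ν_1(H), ν_2(H), ν_3(H), …`. -/
def indicatorSeq [HopfAlgebra k H] : ℕ → k := fun n => indicator k H (n + 1)

/-- The minimal polynomial `p_H` of the sequence of indicators of `H`. -/
def indicatorPolynomial [HopfAlgebra k H] : Polynomial k :=
  LinRec.minimalPolynomial (indicatorSeq k H)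

section Gauge

variable {k H} [Bialgebra k H]

/-- A gauge transformation: an invertible `F ∈ H ⊗ H` with
`(ε ⊗ id)(F) = 1 = (id ⊗ ε)(F)`, where `k ⊗ H = H = H ⊗ k`. -/
def IsGaugeTransformation (F : (H ⊗[k] H)ˣ) : Prop :=
  TensorProduct.lid k H ((Coalgebra.counit (R := k) (A := H)).rTensor H (F : H ⊗[k] H)) = 1 ∧
  TensorProduct.rid k H ((Coalgebra.counit (R := k) (A := H)).lTensor H (F : H ⊗[k] H)) = 1

/-- A 2-cocycle: a gauge transformation `F` with
`(1 ⊗ F) (id ⊗ Δ)(F) (Δ ⊗ id)(F⁻¹) (F⁻¹ ⊗ 1) = 1` in `H ⊗ H ⊗ H`. -/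
def IsTwoCocycle (F : (H ⊗[k] H)ˣ) : Prop :=
  IsGaugeTransformation F ∧
  ((1 : H) ⊗ₜ[k] (F : H ⊗[k] H)) *
    (Coalgebra.comul (R := k) (A := H)).lTensor H (F : H ⊗[k] H) *
    TensorProduct.assoc k H H H
      ((Coalgebra.comul (R := k) (A := H)).rTensor H ((F⁻¹ : (H ⊗[k] H)ˣ) : H ⊗[k] H)) *
    TensorProduct.assoc k H H H (((F⁻¹ : (H ⊗[k] H)ˣ) : H ⊗[k] H) ⊗ₜ[k] (1 : H)) = 1

/-- The twist `H^F`: the algebra `H`, with the same counit and the comultiplication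
`Δ_F(h) = F Δ(h) F⁻¹`. -/
def Twist (_F : (H ⊗[k] H)ˣ) : Type _ := H

namespace Twist

variable (F : (H ⊗[k] H)ˣ)

instance : Ring (Twist F) := inferInstanceAs (Ring H)

instance : Algebra k (Twist F) := inferInstanceAs (Algebra k H)

/-- The identity map `H → H^F`, an isomorphism of algebras. -/
def of : H ≃ₐ[k] Twist F := (AlgEquiv.refl : H ≃ₐ[k] H)

instance : CoalgebraStruct k (Twist F) where
  counit := Coalgebra.counit (R := k) (A := H) ∘ₗ (of F).symm.toLinearMap
  comul :=
    TensorProduct.map (of F).toLinearMap (of F).toLinearMap ∘ₗ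
      LinearMap.mulLeft k (F : H ⊗[k] H) ∘ₗ
      LinearMap.mulRight k ((F⁻¹ : (H ⊗[k] H)ˣ) : H ⊗[k] H) ∘ₗ
      Coalgebra.comul (R := k) (A := H) ∘ₗ (of F).symm.toLinearMap

end Twist

end Gauge

/-- `H` and `H'` are gauge equivalent: `H'` is isomorphic, as a bialgebra, to the twist `H^F` of
`H` by some 2-cocycle `F` of `H`. -/
def GaugeEquivalent (H' : Type*) [Ring H'] [HopfAlgebra k H] [HopfAlgebra k H'] : Prop :=
  ∃ F : (H ⊗[k] H)ˣ, IsTwoCocycle F ∧ Nonempty (H' ≃ₐc[k] Twist F)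

end HopfIndicator

end

/-! Write `D` for left convolution by the identity on `End(H)`. Then `P_{n+1} = D(P_n)`, so the
indicators are values of one linear functional along a `D`-orbit. By Cayley–Hamilton they satisfy
the characteristic polynomial of `D`, whose degree is `dim End(H) = (dim H)^2`.

Gauge invariance holds because the indicators themselves agree (`IsTwistEquiv.indicatorSeq_eq`).
With `F = ∑ f ⊗ g`, `F⁻¹ = ∑ d ⊗ e` and `u = ∑ f S(g)`, one has `u⁻¹ = ∑ S(d) e`. Transported to
`H`, the antipode of the twist is `u S(-) u⁻¹`, and its `m`-fold coproduct is `Δ^{(m)}` conjugated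
by an iterated twist `F_m`. It remains to remove `u` and `F_m` from `Tr(h ↦ m^{(m)}(F_m Δ^{(m)}(u
S(h) u⁻¹) F_m⁻¹))`. `IteratedTwist.trace_twist` does so with two uses of cyclicity of the trace,
joined by the two expressions for `F_{m+1}`. -/

noncomputable section

/-! ### Linear recurrences from Cayley–Hamilton. -/

namespace LinRec

open Polynomial

variable {k : Type*} [Field k]

/-- A sequence `n ↦ L (Dⁿ v)` satisfies the characteristic polynomial of `D`. -/
theorem satisfies_charpoly {V : Type*} [AddCommGroup V] [Module k V] [FiniteDimensional k V]
    (D : V →ₗ[k] V) (L : V →ₗ[k] k) (v : ℕ → V) (hv : ∀ n, v (n + 1) = D (v n)) :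
    Satisfies (fun n => L (v n)) D.charpoly := by
  intro n
  have hpow : ∀ i, v (n + i) = (D ^ i) (v n) := by
    intro i
    induction i with
    | zero => simp
    | succ i ih => rw [← add_assoc, hv, ih, pow_succ', Module.End.mul_apply]
  have h := congrArg (fun f : V →ₗ[k] V => L (f (v n))) D.aeval_self_charpoly
  simp only [aeval_eq_sum_range, LinearMap.sum_apply, LinearMap.smul_apply, map_sum, map_smul,
    LinearMap.zero_apply, map_zero, smul_eq_mul] at h
  rw [sum_over_range _ (by simp)]
  simpa only [hpow] using h

theorem natDegree_minimalPolynomial_le {a : ℕ → k} {p : k[X]} (hp : p.Monic)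
    (h : Satisfies a p) : (minimalPolynomial a).natDegree ≤ p.natDegree :=
  (isMinimalPolynomial_minimalPolynomial ⟨p, hp.ne_zero, h⟩).2.2 p hp h

end LinRec

namespace HopfIndicator

/-! ### Sweedler powers as convolution powers of the identity. -/

section SweedlerPower

variable (k : Type*) [Field k] (H : Type*) [Ring H]

theorem iterMul_tensorCons [Algebra k H] (n : ℕ) (t : H ⊗[k] (⨂[k]^n H)) :
    iterMul k H (n + 1) (tensorCons k H n t) =
      LinearMap.mul' k H ((iterMul k H n).lTensor H t) := by
  refine LinearMap.congr_fun (f := iterMul k H (n + 1) ∘ₗ tensorCons k H n)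
    (g := LinearMap.mul' k H ∘ₗ (iterMul k H n).lTensor H) ?_ t
  ext x y
  simp [tensorCons, iterMul, List.ofFn_succ]

variable [Bialgebra k H]

/-- Left convolution by the identity. -/
def convId : (H →ₗ[k] H) →ₗ[k] (H →ₗ[k] H) where
  toFun f := LinearMap.mul' k H ∘ₗ f.lTensor H ∘ₗ Coalgebra.comul
  map_add' f g := by ext; simp [LinearMap.lTensor_add]
  map_smul' c f := by ext; simp [LinearMap.lTensor_smul]

theorem convId_apply (f : H →ₗ[k] H) (h : H) :
    convId k H f h = LinearMap.mul' k H (f.lTensor H (Coalgebra.comul (R := k) h)) := rfl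

theorem sweedlerPower_one : sweedlerPower k H 1 = LinearMap.id := by
  ext h
  simp [sweedlerPower, iterMul, iterComul]

/-- `P_0` is the convolution unit, and `Δ^{(n+1)}` and `m^{(n+1)}` both split off the first tensor
factor. -/
theorem sweedlerPower_succ (n : ℕ) :
    sweedlerPower k H (n + 1) = convId k H (sweedlerPower k H n) := by
  cases n with
  | zero =>
    rw [sweedlerPower_one]
    ext h
    rw [convId_apply, sweedlerPower, LinearMap.lTensor_comp, LinearMap.comp_apply,
      Coalgebra.lTensor_counit_comul]
    simp
  | succ n =>
    ext h
    rw [convId_apply]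
    simp only [sweedlerPower, iterComul, LinearMap.comp_apply, iterMul_tensorCons,
      LinearMap.lTensor_comp]

end SweedlerPower

/-! ### Linear recursiveness and the degree bound. -/

section Recursion

variable (k : Type*) [Field k] (H : Type*) [Ring H] [HopfAlgebra k H] [FiniteDimensional k H]

theorem indicatorSeq_satisfies : LinRec.Satisfies (indicatorSeq k H) (convId k H).charpoly :=
  LinRec.satisfies_charpoly (convId k H)
    (LinearMap.trace k H ∘ₗ LinearMap.compRight k (HopfAlgebra.antipode k)) (sweedlerPower k H)
    (sweedlerPower_succ k H)

theorem isLinearlyRecursive_indicatorSeq : LinRec.IsLinearlyRecursive (indicatorSeq k H) :=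
  ⟨_, (LinearMap.charpoly_monic _).ne_zero, indicatorSeq_satisfies k H⟩

theorem natDegree_indicatorPolynomial_le :
    (indicatorPolynomial k H).natDegree ≤ Module.finrank k H ^ 2 := by
  refine (LinRec.natDegree_minimalPolynomial_le (LinearMap.charpoly_monic _)
    (indicatorSeq_satisfies k H)).trans ?_
  rw [LinearMap.charpoly_natDegree, Module.finrank_linearMap, sq]

end Recursion

/-! ### The element `u` of a 2-cocycle and its inverse. -/

section TwistElement

variable {k : Type*} [Field k] {H : Type*} [Ring H] [HopfAlgebra k H]

local notation "S" => HopfAlgebra.antipode k (A := H)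

/-- The map `x ⊗ y ↦ x S(y)`. -/
def mulAntipode : H ⊗[k] H →ₗ[k] H := LinearMap.mul' k H ∘ₗ (S).lTensor H

/-- The map `x ⊗ y ↦ S(x) c y`. -/
def antipodeMul (c : H) : H ⊗[k] H →ₗ[k] H :=
  LinearMap.mul' k H ∘ₗ TensorProduct.map (S) (LinearMap.mulLeft k c)

@[simp] theorem mulAntipode_tmul (x y : H) : mulAntipode (k := k) (x ⊗ₜ[k] y) = x * S y := rfl

@[simp] theorem antipodeMul_tmul (c x y : H) :
    antipodeMul (k := k) c (x ⊗ₜ[k] y) = S x * (c * y) := rfl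

theorem antipodeMul_add (c d : H) (t : H ⊗[k] H) :
    antipodeMul (c + d) t = antipodeMul c t + antipodeMul d t := by
  refine LinearMap.congr_fun (f := antipodeMul _) (g := antipodeMul _ + antipodeMul _) ?_ t
  ext; simp [add_mul, mul_add]

theorem antipodeMul_smul_one (a : k) (t : H ⊗[k] H) :
    antipodeMul (a • 1) t = a • antipodeMul 1 t := by
  refine LinearMap.congr_fun (f := antipodeMul _) (g := a • antipodeMul _) ?_ t
  ext; simp

/-- Since `S` reverses products, `x ⊗ y` acts on `H` from the right by `c ↦ S(x) c y`. Products in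
`H ⊗ H` can thus be absorbed one factor at a time. -/
theorem antipodeMul_mul (c : H) (s t : H ⊗[k] H) :
    antipodeMul c (s * t) = antipodeMul (antipodeMul c s) t := by
  induction s with
  | zero => simp [antipodeMul]
  | add s s' hs hs' => rw [add_mul, map_add, hs, hs', map_add, antipodeMul_add]
  | tmul a b =>
    induction t with
    | zero => simp
    | add t t' ht ht' => rw [mul_add, map_add, ht, ht', map_add]
    | tmul c d => simp [HopfAlgebra.antipode_mul_antidistrib, mul_assoc]

theorem antipodeMul_one_comul (h : H) :
    antipodeMul 1 (Coalgebra.comul (R := k) h) = (Coalgebra.counit h : k) • 1 := by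
  have := HopfAlgebra.mul_antipode_rTensor_comul_apply (R := k) h
  rw [Algebra.algebraMap_eq_smul_one] at this
  rw [← this]
  refine LinearMap.congr_fun (f := antipodeMul _) (g := LinearMap.mul' k H ∘ₗ (S).rTensor H) ?_ _
  ext; simp

variable (F : (H ⊗[k] H)ˣ)

/-- The element `∑ f S(g)` for `F = ∑ f ⊗ g`. -/
def twistElt : H := mulAntipode (F : H ⊗[k] H)

/-- The element `∑ S(d) e` for `F⁻¹ = ∑ d ⊗ e`. -/
def twistEltInv : H := antipodeMul 1 ((F⁻¹ : (H ⊗[k] H)ˣ) : H ⊗[k] H)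

theorem antipodeMul_twistEltInv : antipodeMul (twistEltInv F) (F : H ⊗[k] H) = 1 := by
  rw [twistEltInv, ← antipodeMul_mul, Units.inv_mul, Algebra.TensorProduct.one_def]
  simp

/-- The map `x ⊗ y ⊗ z ↦ x S(y) z`. -/
def altMul : H ⊗[k] (H ⊗[k] H) →ₗ[k] H := LinearMap.mul' k H ∘ₗ (antipodeMul 1).lTensor H

/-- For `s = a ⊗ b` and `t = c ⊗ d` the left side is `a c₁ S(c₂) S(b₁) b₂ d`, and both inner pairs
collapse to counits. -/
theorem altMul_comul_comul (s t : H ⊗[k] H) :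
    altMul ((Coalgebra.comul (R := k) (A := H)).lTensor H s *
        TensorProduct.assoc k H H H ((Coalgebra.comul (R := k) (A := H)).rTensor H t)) =
      TensorProduct.rid k H ((Coalgebra.counit (R := k) (A := H)).lTensor H s) *
        TensorProduct.lid k H ((Coalgebra.counit (R := k) (A := H)).rTensor H t) := by
  induction s with
  | zero => simp
  | add s s' hs hs' => simp only [map_add, add_mul, hs, hs']
  | tmul a b =>
    induction t with
    | zero => simp
    | add t t' ht ht' => simp only [map_add, mul_add, ht, ht']
    | tmul c d =>
      have key : ∀ r : H ⊗[k] H,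
          altMul ((a ⊗ₜ[k] Coalgebra.comul (R := k) b) * TensorProduct.assoc k H H H (r ⊗ₜ[k] d)) =
            a * ((Coalgebra.counit b : k) • mulAntipode r) * d := by
        intro r
        induction r with
        | zero => simp
        | add r r' hr hr' => simp only [map_add, TensorProduct.add_tmul, mul_add, add_mul, hr, hr',
            smul_add]
        | tmul x y =>
          simp [altMul, antipodeMul_mul, antipodeMul_one_comul, mul_assoc]
      have h2 : mulAntipode (Coalgebra.comul (R := k) c) = (Coalgebra.counit c : k) • 1 := by
        rw [mulAntipode, LinearMap.comp_apply, HopfAlgebra.mul_antipode_lTensor_comul_apply,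
          Algebra.algebraMap_eq_smul_one]
      rw [LinearMap.lTensor_tmul, LinearMap.rTensor_tmul, key, h2]
      simp [smul_comm (Coalgebra.counit b : k)]

theorem altMul_one_tmul_tmul_one (s t : H ⊗[k] H) :
    altMul (((1 : H) ⊗ₜ[k] s) * TensorProduct.assoc k H H H (t ⊗ₜ[k] (1 : H))) =
      mulAntipode t * antipodeMul 1 s := by
  induction s with
  | zero => simp
  | add s s' hs hs' => simp only [map_add, add_mul, mul_add, TensorProduct.tmul_add, hs, hs']
  | tmul a b =>
    induction t with
    | zero => simp
    | add t t' ht ht' => simp only [map_add, mul_add, add_mul, TensorProduct.add_tmul, ht, ht']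
    | tmul c d => simp [altMul, HopfAlgebra.antipode_mul_antidistrib, mul_assoc]

variable {F}

theorem IsTwoCocycle.comul_mul_comul (hF : IsTwoCocycle F) :
    (Coalgebra.comul (R := k) (A := H)).lTensor H (F : H ⊗[k] H) *
      TensorProduct.assoc k H H H
        ((Coalgebra.comul (R := k) (A := H)).rTensor H ((F⁻¹ : (H ⊗[k] H)ˣ) : H ⊗[k] H)) =
    ((1 : H) ⊗ₜ[k] ((F⁻¹ : (H ⊗[k] H)ˣ) : H ⊗[k] H)) *
      TensorProduct.assoc k H H H ((F : H ⊗[k] H) ⊗ₜ[k] (1 : H)) := by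
  have h := hF.2
  have h1 : ((1 : H) ⊗ₜ[k] ((F⁻¹ : (H ⊗[k] H)ˣ) : H ⊗[k] H)) * ((1 : H) ⊗ₜ[k] (F : H ⊗[k] H)) =
      1 := by
    rw [Algebra.TensorProduct.tmul_mul_tmul, Units.inv_mul, mul_one,
      ← Algebra.TensorProduct.one_def]
  have h2 : TensorProduct.assoc k H H H (((F⁻¹ : (H ⊗[k] H)ˣ) : H ⊗[k] H) ⊗ₜ[k] (1 : H)) *
      TensorProduct.assoc k H H H ((F : H ⊗[k] H) ⊗ₜ[k] (1 : H)) = 1 := by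
    have := map_mul (Algebra.TensorProduct.assoc k k k H H H)
      (((F⁻¹ : (H ⊗[k] H)ˣ) : H ⊗[k] H) ⊗ₜ[k] (1 : H)) ((F : H ⊗[k] H) ⊗ₜ[k] (1 : H))
    rw [Algebra.TensorProduct.tmul_mul_tmul, Units.inv_mul, mul_one,
      ← Algebra.TensorProduct.one_def, map_one] at this
    exact this.symm
  have h3 := congrArg (fun x => ((1 : H) ⊗ₜ[k] ((F⁻¹ : (H ⊗[k] H)ˣ) : H ⊗[k] H)) * x *
    TensorProduct.assoc k H H H ((F : H ⊗[k] H) ⊗ₜ[k] (1 : H))) h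
  simp only [mul_assoc, h2, mul_one] at h3
  rw [← mul_assoc, h1, one_mul] at h3
  simpa using h3

/-- Apply `x ⊗ y ⊗ z ↦ x S(y) z` to both sides of `comul_mul_comul`: one side gives the product
sought, the other only counit contractions of `F` and `F⁻¹`. -/
theorem IsTwoCocycle.twistElt_mul_twistEltInv (hF : IsTwoCocycle F) :
    twistElt F * twistEltInv F = 1 := by
  rw [twistElt, twistEltInv, ← altMul_one_tmul_tmul_one, ← hF.comul_mul_comul,
    altMul_comul_comul, hF.1.2, one_mul]
  -- Normalization is assumed for `F` only; it passes to `F⁻¹` because `ε ⊗ id` is an algebra map.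
  have h1 : Algebra.TensorProduct.lid k H ((Algebra.TensorProduct.map (Bialgebra.counitAlgHom k H)
      (AlgHom.id k H)) (F : H ⊗[k] H)) = 1 := hF.1.1
  have h2 := map_mul ((Algebra.TensorProduct.lid k H).toAlgHom.comp
    (Algebra.TensorProduct.map (Bialgebra.counitAlgHom k H) (AlgHom.id k H)))
    (F : H ⊗[k] H) ((F⁻¹ : (H ⊗[k] H)ˣ) : H ⊗[k] H)
  rw [Units.mul_inv, map_one] at h2
  have h3 := h2.symm
  simp only [AlgHom.comp_apply] at h3
  erw [h1, one_mul] at h3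
  exact h3

/-- The cocycle identity `(1 ⊗ F) (id ⊗ Δ)(F) = (F ⊗ 1) (Δ ⊗ id)(F)`. -/
theorem IsTwoCocycle.cocycle (hF : IsTwoCocycle F) :
    ((1 : H) ⊗ₜ[k] (F : H ⊗[k] H)) *
      Algebra.TensorProduct.map (AlgHom.id k H) (Bialgebra.comulAlgHom k H) (F : H ⊗[k] H) =
    Algebra.TensorProduct.assoc k k k H H H ((F : H ⊗[k] H) ⊗ₜ[k] (1 : H)) *
      Algebra.TensorProduct.assoc k k k H H H
        (Algebra.TensorProduct.map (Bialgebra.comulAlgHom k H) (AlgHom.id k H) (F : H ⊗[k] H)) := by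
  have h : ((1 : H) ⊗ₜ[k] (F : H ⊗[k] H)) *
      Algebra.TensorProduct.map (AlgHom.id k H) (Bialgebra.comulAlgHom k H) (F : H ⊗[k] H) *
      Algebra.TensorProduct.assoc k k k H H H
        (Algebra.TensorProduct.map (Bialgebra.comulAlgHom k H) (AlgHom.id k H)
          ((F⁻¹ : (H ⊗[k] H)ˣ) : H ⊗[k] H)) *
      Algebra.TensorProduct.assoc k k k H H H
        (((F⁻¹ : (H ⊗[k] H)ˣ) : H ⊗[k] H) ⊗ₜ[k] (1 : H)) = 1 := hF.2
  set X := ((1 : H) ⊗ₜ[k] (F : H ⊗[k] H)) *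
      Algebra.TensorProduct.map (AlgHom.id k H) (Bialgebra.comulAlgHom k H) (F : H ⊗[k] H)
  have h1 : Algebra.TensorProduct.assoc k k k H H H (((F⁻¹ : (H ⊗[k] H)ˣ) : H ⊗[k] H) ⊗ₜ[k] (1 : H)) *
      Algebra.TensorProduct.assoc k k k H H H ((F : H ⊗[k] H) ⊗ₜ[k] (1 : H)) = 1 := by
    rw [← map_mul, Algebra.TensorProduct.tmul_mul_tmul, Units.inv_mul, mul_one,
      ← Algebra.TensorProduct.one_def, map_one]
  have h2 : Algebra.TensorProduct.assoc k k k H H H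
        (Algebra.TensorProduct.map (Bialgebra.comulAlgHom k H) (AlgHom.id k H)
          ((F⁻¹ : (H ⊗[k] H)ˣ) : H ⊗[k] H)) * Algebra.TensorProduct.assoc k k k H H H
        (Algebra.TensorProduct.map (Bialgebra.comulAlgHom k H) (AlgHom.id k H) (F : H ⊗[k] H)) =
      1 := by
    rw [← map_mul, ← map_mul, Units.inv_mul, map_one, map_one]
  generalize Algebra.TensorProduct.assoc k k k H H H
    (((F⁻¹ : (H ⊗[k] H)ˣ) : H ⊗[k] H) ⊗ₜ[k] (1 : H)) = D at h h1
  generalize Algebra.TensorProduct.assoc k k k H H H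
        (Algebra.TensorProduct.map (Bialgebra.comulAlgHom k H) (AlgHom.id k H)
          ((F⁻¹ : (H ⊗[k] H)ˣ) : H ⊗[k] H)) = C at h h2
  rw [← left_inv_eq_right_inv h h1, mul_assoc, mul_assoc, h2, mul_one]

end TwistElement

/-! ### Transport of the twisted structure to `H`; the twisted antipode. -/

/-- Twist data: a bijective algebra map `φ` onto `H`, compatible with the counits, which carries the
comultiplication to `F Δ(-) F⁻¹`. -/
structure IsTwistEquiv {k : Type*} [Field k] {H H' : Type*} [Ring H] [HopfAlgebra k H] [Ring H']
    [HopfAlgebra k H'] (F : (H ⊗[k] H)ˣ) (φ : H' ≃ₐ[k] H) : Prop where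
  counit : ∀ x, Coalgebra.counit (R := k) (φ x) = Coalgebra.counit (R := k) x
  comul : ∀ x, TensorProduct.map φ.toLinearMap φ.toLinearMap (Coalgebra.comul (R := k) x) =
    F * Coalgebra.comul (R := k) (φ x) * ((F⁻¹ : (H ⊗[k] H)ˣ) : H ⊗[k] H)

section IsTwistEquiv

variable {k : Type*} [Field k] {H H' : Type*} [Ring H] [HopfAlgebra k H] [Ring H']
    [HopfAlgebra k H'] {F : (H ⊗[k] H)ˣ}

theorem exists_isTwistEquiv (e : H' ≃ₐc[k] Twist F) : ∃ φ : H' ≃ₐ[k] H, IsTwistEquiv F φ := by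
  refine ⟨(e : H' ≃ₐ[k] Twist F).trans (Twist.of F).symm, fun x => ?_, fun x => ?_⟩
  · exact CoalgHomClass.counit_comp_apply e x
  · have h := CoalgHomClass.map_comp_comul_apply e x
    apply_fun TensorProduct.map (Twist.of F).symm.toLinearMap (Twist.of F).symm.toLinearMap at h
    rw [← LinearMap.comp_apply, ← TensorProduct.map_comp] at h
    refine h.trans ?_
    change TensorProduct.map (Twist.of F).symm.toLinearMap (Twist.of F).symm.toLinearMap
      (TensorProduct.map (Twist.of F).toLinearMap (Twist.of F).toLinearMap _) = _
    rw [← LinearMap.comp_apply, ← TensorProduct.map_comp]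
    have : (Twist.of F).symm.toLinearMap ∘ₗ (Twist.of F).toLinearMap = LinearMap.id := rfl
    rw [this, TensorProduct.map_id, mul_assoc]
    rfl

open WithConv in
-- A left convolution inverse of the identity equals its right inverse, the antipode.
theorem eq_antipode_of_mul_id (s : H' →ₗ[k] H')
    (hs : ∀ x, LinearMap.mul' k H' (s.rTensor H' (Coalgebra.comul (R := k) x)) =
      algebraMap k H' (Coalgebra.counit x)) : s = HopfAlgebra.antipode k := by
  have h : toConv s * toConv LinearMap.id = 1 := by
    ext x
    exact hs x
  exact toConv_injective (left_inv_eq_right_inv h LinearMap.id_mul_antipode)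

theorem IsTwistEquiv.antipode {φ : H' ≃ₐ[k] H} (h : IsTwistEquiv F φ) (hF : IsTwoCocycle F)
    (x : H') : φ (HopfAlgebra.antipode k x) =
      twistElt F * HopfAlgebra.antipode k (φ x) * twistEltInv F := by
  let A : H →ₗ[k] H := LinearMap.mulLeft k (twistElt F) ∘ₗ LinearMap.mulRight k (twistEltInv F) ∘ₗ
    HopfAlgebra.antipode k
  have hA : φ.symm.toLinearMap ∘ₗ A ∘ₗ φ.toLinearMap = HopfAlgebra.antipode k := by
    refine eq_antipode_of_mul_id _ fun x => φ.injective ?_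
    have h1 : ∀ t : H' ⊗[k] H', φ (LinearMap.mul' k H'
        ((φ.symm.toLinearMap ∘ₗ A ∘ₗ φ.toLinearMap).rTensor H' t)) =
        twistElt F * antipodeMul (twistEltInv F)
          (TensorProduct.map φ.toLinearMap φ.toLinearMap t) := by
      intro t
      induction t with
      | zero => simp
      | add t t' ht ht' => simp only [map_add, ht, ht', mul_add]
      | tmul a b => simp [A, mul_assoc]
    -- Absorb `F`, `Δ(φ x)` and `F⁻¹` in turn: `u⁻¹` becomes `1`, then `ε(x) 1`, then `ε(x) u⁻¹`,
    -- and the outer `u` cancels.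
    rw [h1, h.comul, antipodeMul_mul, antipodeMul_mul, antipodeMul_twistEltInv,
      antipodeMul_one_comul, antipodeMul_smul_one, ← twistEltInv, mul_smul_comm,
      hF.twistElt_mul_twistEltInv, h.counit, AlgEquiv.commutes, Algebra.algebraMap_eq_smul_one]
  rw [← hA]
  simp [A, mul_assoc]

end IsTwistEquiv

-- Iterated twists on tensor powers, built by induction on `m`.

universe v'

/-- The algebra `B = H^{⊗ m}` for some `m ≥ 1`, with the iterated coproduct `δ = Δ^{(m)}`, the
iterated twist `Φ = F_m`, the multiplication map `κ`, the map `ρ b = b ⊗ 1` and the map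
`M = Δ^{(m)} ⊗ id`. -/
structure IteratedTwist {k : Type*} [Field k] {H : Type v'} [Ring H] [HopfAlgebra k H]
    (F : (H ⊗[k] H)ˣ) where
  /-- The tensor power. -/
  B : Type v'
  [ring : Ring B]
  [algebra : Algebra k B]
  /-- The iterated coproduct. -/
  δ : H →ₐ[k] B
  /-- The iterated twist. -/
  Φ : Bˣ
  /-- The multiplication map. -/
  κ : B →ₗ[k] H
  /-- The inclusion that leaves out the last tensor factor. -/
  ρ : B →ₐ[k] H ⊗[k] B
  /-- The iterated coproduct in the first tensor factor. -/
  M : H ⊗[k] H →ₐ[k] H ⊗[k] B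
  M_comul : ∀ h, M (Coalgebra.comul (R := k) h) =
    Algebra.TensorProduct.map (AlgHom.id k H) δ (Coalgebra.comul (R := k) h)
  -- The two expressions for `F_{m+1}`: `(1 ⊗ F_m)(id ⊗ Δ^{(m)})(F) = (F_m ⊗ 1)(Δ^{(m)} ⊗ id)(F)`.
  M_twist : ((1 : H) ⊗ₜ[k] (Φ : B)) * Algebra.TensorProduct.map (AlgHom.id k H) δ (F : H ⊗[k] H) =
    ρ Φ * M F
  M_tmul_one : ∀ x, M (x ⊗ₜ[k] 1) = ρ (δ x)
  -- The shift by one slot interleaves the factors: both sides are `z₁ b₁ z₂ b₂ ⋯ z_m b_m`.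
  κ_rotate : ∀ b z, LinearMap.mul' k H (κ.lTensor H (((1 : H) ⊗ₜ[k] b) * ρ z)) = κ (z * b)
  κ_last : ∀ y w c, LinearMap.mul' k H (κ.lTensor H (ρ y * M ((1 : H) ⊗ₜ[k] c) * ρ w)) =
    κ (y * w) * c

namespace IteratedTwist

attribute [instance] ring algebra

variable {k : Type*} [Field k] {H : Type v'} [Ring H] [HopfAlgebra k H] {F : (H ⊗[k] H)ˣ}

/-- The case `m = 1`. -/
def base (F : (H ⊗[k] H)ˣ) : IteratedTwist F where
  B := H
  δ := AlgHom.id k H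
  Φ := 1
  κ := LinearMap.id
  ρ := Algebra.TensorProduct.includeLeft
  M := AlgHom.id k _
  M_comul h := by simp
  M_twist := by simp [← Algebra.TensorProduct.one_def]
  M_tmul_one x := by simp
  κ_rotate b z := by simp
  κ_last y w c := by simp

variable (L : IteratedTwist F)

theorem mul_lTensor_tmul_mul (h : H) (t : H ⊗[k] L.B) :
    LinearMap.mul' k H (L.κ.lTensor H ((h ⊗ₜ[k] 1) * t)) =
      h * LinearMap.mul' k H (L.κ.lTensor H t) := by
  induction t with
  | zero => simp
  | add t t' ht ht' => simp only [mul_add, map_add, ht, ht']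
  | tmul a b => simp [mul_assoc]

/-- The map `M` for `m + 1`. -/
def M₁ : H ⊗[k] H →ₐ[k] H ⊗[k] (H ⊗[k] L.B) :=
  (Algebra.TensorProduct.map (AlgHom.id k H) L.M).comp
    ((Algebra.TensorProduct.assoc k k k H H H).toAlgHom.comp
      (Algebra.TensorProduct.map (Bialgebra.comulAlgHom k H) (AlgHom.id k H)))

/-- The map `δ` for `m + 1`. -/
def δ₁ : H →ₐ[k] H ⊗[k] L.B :=
  (Algebra.TensorProduct.map (AlgHom.id k H) L.δ).comp (Bialgebra.comulAlgHom k H)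

/-- The element `Φ` for `m + 1`. -/
def Φ₁ : (H ⊗[k] L.B)ˣ :=
  Units.map (Algebra.TensorProduct.includeRight : L.B →ₐ[k] H ⊗[k] L.B) L.Φ *
    Units.map (Algebra.TensorProduct.map (AlgHom.id k H) L.δ) F

theorem map_δ₁ (t : H ⊗[k] H) : Algebra.TensorProduct.map (AlgHom.id k H) L.δ₁ t =
    Algebra.TensorProduct.map (AlgHom.id k H) L.M
      (Algebra.TensorProduct.map (AlgHom.id k H) (Bialgebra.comulAlgHom k H) t) := by
  induction t with
  | zero => simp
  | add t t' ht ht' => simp only [map_add, ht, ht']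
  | tmul a b => simp [δ₁, M_comul]

theorem M₁_comul (h : H) : L.M₁ (Coalgebra.comul (R := k) h) =
    Algebra.TensorProduct.map (AlgHom.id k H) L.δ₁ (Coalgebra.comul (R := k) h) := by
  rw [map_δ₁]
  exact congrArg (Algebra.TensorProduct.map (AlgHom.id k H) L.M) (Coalgebra.coassoc_apply h)

theorem map_M_assoc_tmul_one (t : H ⊗[k] H) : Algebra.TensorProduct.map (AlgHom.id k H) L.M
      (Algebra.TensorProduct.assoc k k k H H H (t ⊗ₜ[k] (1 : H))) =
    Algebra.TensorProduct.map (AlgHom.id k H) L.ρ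
      (Algebra.TensorProduct.map (AlgHom.id k H) L.δ t) := by
  induction t with
  | zero => simp
  | add t t' ht ht' => simp only [TensorProduct.add_tmul, map_add, ht, ht']
  | tmul a b => simp [M_tmul_one]

/-- Use the identity for `m` inside the last factors, then the image under `id ⊗ M` of the cocycle
identity for `F`. -/
theorem M₁_twist (hF : IsTwoCocycle F) :
    ((1 : H) ⊗ₜ[k] (((1 : H) ⊗ₜ[k] (L.Φ : L.B)) *
        Algebra.TensorProduct.map (AlgHom.id k H) L.δ (F : H ⊗[k] H))) *
      Algebra.TensorProduct.map (AlgHom.id k H) L.δ₁ (F : H ⊗[k] H) =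
    Algebra.TensorProduct.map (AlgHom.id k H) L.ρ (((1 : H) ⊗ₜ[k] (L.Φ : L.B)) *
        Algebra.TensorProduct.map (AlgHom.id k H) L.δ (F : H ⊗[k] H)) * L.M₁ F := by
  have h : (1 : H) ⊗ₜ[k] (L.ρ L.Φ * L.M F) =
      ((1 : H) ⊗ₜ[k] L.ρ L.Φ) * Algebra.TensorProduct.map (AlgHom.id k H) L.M
        ((1 : H) ⊗ₜ[k] (F : H ⊗[k] H)) := by simp
  conv_lhs => rw [M_twist, map_δ₁, h, mul_assoc, ← map_mul, hF.cocycle, map_mul,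
    map_M_assoc_tmul_one]
  rw [map_mul, mul_assoc]
  simp [M₁]

/-- Passing from `m` to `m + 1`. -/
def next (hF : IsTwoCocycle F) : IteratedTwist F where
  B := H ⊗[k] L.B
  δ := L.δ₁
  Φ := L.Φ₁
  κ := LinearMap.mul' k H ∘ₗ L.κ.lTensor H
  ρ := Algebra.TensorProduct.map (AlgHom.id k H) L.ρ
  M := L.M₁
  M_comul := L.M₁_comul
  M_twist := L.M₁_twist hF
  M_tmul_one x := L.map_M_assoc_tmul_one (Coalgebra.comul (R := k) x)
  κ_rotate b z := by
    induction b with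
    | zero => simp
    | add t t' ht ht' => simp only [TensorProduct.tmul_add, add_mul, mul_add, map_add, ht, ht']
    | tmul b₁ b' =>
      induction z with
      | zero => simp
      | add t t' ht ht' => simp only [add_mul, mul_add, map_add, ht, ht']
      | tmul z₁ z' =>
        have h : (b₁ ⊗ₜ[k] b') * L.ρ z' = (b₁ ⊗ₜ[k] 1) * (((1 : H) ⊗ₜ[k] b') * L.ρ z') := by
          rw [← mul_assoc]; simp
        simp [h, mul_lTensor_tmul_mul, κ_rotate, mul_assoc]
  κ_last y w c := by
    induction y with
    | zero => simp
    | add t t' ht ht' => simp only [add_mul, map_add, ht, ht']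
    | tmul b₁ b' =>
      induction w with
      | zero => simp
      | add t t' ht ht' => simp only [add_mul, mul_add, map_add, ht, ht']
      | tmul z₁ z' =>
        have h : L.M₁ ((1 : H) ⊗ₜ[k] c) = (1 : H) ⊗ₜ[k] L.M ((1 : H) ⊗ₜ[k] c) := by
          simp [M₁, Algebra.TensorProduct.one_def]
        have h' := L.κ_last b' z' c
        rw [mul_assoc] at h'
        rw [h]
        simp [h', mul_assoc]

/-- The data for `m = n + 1`. -/
def iter (hF : IsTwoCocycle F) : ℕ → IteratedTwist F
  | 0 => base F
  | n + 1 => (iter hF n).next hF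

theorem κ_δ (hF : IsTwoCocycle F) (n : ℕ) (h : H) :
    (iter hF n).κ ((iter hF n).δ h) = sweedlerPower k H (n + 1) h := by
  induction n generalizing h with
  | zero => rw [sweedlerPower_one]; rfl
  | succ n ih =>
    rw [sweedlerPower_succ, convId_apply]
    change LinearMap.mul' k H ((iter hF n).κ.lTensor H
      ((iter hF n).δ.toLinearMap.lTensor H (Coalgebra.comul (R := k) h))) = _
    rw [← LinearMap.lTensor_comp_apply]
    have : (iter hF n).κ ∘ₗ (iter hF n).δ.toLinearMap = sweedlerPower k H (n + 1) :=
      LinearMap.ext ih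
    rw [this]

/-- Iterating `F Δ(-) F⁻¹` conjugates by `(1 ⊗ F_m)(id ⊗ Δ^{(m)})(F)`, which is the recursive
definition of `F_{m+1}`. -/
theorem κ_twist {H' : Type*} [Ring H'] [HopfAlgebra k H'] {φ : H' ≃ₐ[k] H}
    (hφ : IsTwistEquiv F φ) (hF : IsTwoCocycle F) (n : ℕ) (x : H') :
    φ (sweedlerPower k H' (n + 1) x) = (iter hF n).κ ((iter hF n).Φ * (iter hF n).δ (φ x) *
      (((iter hF n).Φ⁻¹ : (iter hF n).Bˣ) : (iter hF n).B)) := by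
  induction n generalizing x with
  | zero =>
    rw [sweedlerPower_one]
    change φ x = ((1 : Hˣ) : H) * φ x * ((1⁻¹ : Hˣ) : H)
    simp
  | succ n ih =>
    rw [sweedlerPower_succ, convId_apply]
    set L := iter hF n with hL
    let A : H →ₗ[k] L.B := LinearMap.mulLeft k (L.Φ : L.B) ∘ₗ
      LinearMap.mulRight k ((L.Φ⁻¹ : L.Bˣ) : L.B) ∘ₗ L.δ.toLinearMap
    have h1 : ∀ t : H' ⊗[k] H', φ (LinearMap.mul' k H' ((sweedlerPower k H' (n + 1)).lTensor H' t)) =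
        LinearMap.mul' k H (L.κ.lTensor H (A.lTensor H
          (TensorProduct.map φ.toLinearMap φ.toLinearMap t))) := by
      intro t
      induction t with
      | zero => simp
      | add t t' ht ht' => simp only [map_add, ht, ht']
      | tmul a b => simp [A, ih, mul_assoc]
    have h2 : ∀ t : H ⊗[k] H, A.lTensor H t = ((1 : H) ⊗ₜ[k] (L.Φ : L.B)) *
        Algebra.TensorProduct.map (AlgHom.id k H) L.δ t *
        ((1 : H) ⊗ₜ[k] ((L.Φ⁻¹ : L.Bˣ) : L.B)) := by
      intro t
      induction t with
      | zero => simp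
      | add t t' ht ht' => simp only [map_add, ht, ht', mul_add, add_mul]
      | tmul a b => simp [A, mul_assoc]
    rw [h1, hφ.comul, h2, map_mul (Algebra.TensorProduct.map (AlgHom.id k H) L.δ),
      map_mul (Algebra.TensorProduct.map (AlgHom.id k H) L.δ)]
    change _ = LinearMap.mul' k H (L.κ.lTensor H
      ((L.Φ₁ : H ⊗[k] L.B) * L.δ₁ (φ x) * ((L.Φ₁⁻¹ : (H ⊗[k] L.B)ˣ) : H ⊗[k] L.B)))
    simp only [Φ₁, mul_inv_rev, mul_assoc, Units.val_mul]
    rfl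

/-- Cyclicity expands `u` into a full factor `F`, `M_twist` moves `F_m` past it, and a second use of
cyclicity cancels `F_m` with `F_m⁻¹` and `F` with `u⁻¹`. -/
theorem trace_twist (L : IteratedTwist F) :
    LinearMap.trace k H (L.κ ∘ₗ LinearMap.mulLeft k (L.Φ : L.B) ∘ₗ
      LinearMap.mulRight k ((L.Φ⁻¹ : L.Bˣ) : L.B) ∘ₗ L.δ.toLinearMap ∘ₗ
      LinearMap.mulLeft k (twistElt F) ∘ₗ LinearMap.mulRight k (twistEltInv F) ∘ₗ
      HopfAlgebra.antipode k) =
    LinearMap.trace k H (L.κ ∘ₗ L.δ.toLinearMap ∘ₗ HopfAlgebra.antipode k) := by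
  -- `Z h = δ(S(h)) δ(u⁻¹) Φ⁻¹` collects everything to the right of `Φ δ(u)`.
  let W : L.B := L.δ (twistEltInv F) * ((L.Φ⁻¹ : L.Bˣ) : L.B)
  let Z : H →ₗ[k] L.B := LinearMap.mulRight k W ∘ₗ L.δ.toLinearMap ∘ₗ HopfAlgebra.antipode k
  let κ' : H ⊗[k] L.B →ₗ[k] H := LinearMap.mul' k H ∘ₗ L.κ.lTensor H
  have left_add : ∀ {A : Type v'} [Ring A] [Algebra k A] (a b : A),
      LinearMap.mulLeft k (a + b) = LinearMap.mulLeft k a + LinearMap.mulLeft k b :=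
    fun a b => LinearMap.ext fun x => add_mul a b x
  have right_add : ∀ {A : Type v'} [Ring A] [Algebra k A] (a b : A),
      LinearMap.mulRight k (a + b) = LinearMap.mulRight k a + LinearMap.mulRight k b :=
    fun a b => LinearMap.ext fun x => mul_add x a b
  -- For `t = f ⊗ g`, `S(g) S(h) = S(h g)` turns `S(g)` into right multiplication by `g` before the
  -- map. Cyclicity moves it after the map, where `κ_last` reads `g` as an extra last tensor factor.
  have step₁ : ∀ t : H ⊗[k] H,
      LinearMap.trace k H (L.κ ∘ₗ LinearMap.mulLeft k ((L.Φ : L.B) * L.δ (mulAntipode t)) ∘ₗ Z) =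
      LinearMap.trace k H (κ' ∘ₗ LinearMap.mulLeft k (L.ρ L.Φ * L.M t) ∘ₗ L.ρ.toLinearMap ∘ₗ Z) := by
    intro t
    induction t with
    | zero => simp
    | add t t' ht ht' =>
      simp only [map_add, mul_add, left_add, LinearMap.add_comp, LinearMap.comp_add,
        ht, ht']
    | tmul f g =>
      have e₁ : L.κ ∘ₗ LinearMap.mulLeft k ((L.Φ : L.B) * L.δ (mulAntipode (f ⊗ₜ[k] g))) ∘ₗ Z =
          (L.κ ∘ₗ LinearMap.mulLeft k ((L.Φ : L.B) * L.δ f) ∘ₗ Z) ∘ₗ LinearMap.mulRight k g := by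
        ext h
        simp [Z, HopfAlgebra.antipode_mul_antidistrib, mul_assoc]
      have e₂ : κ' ∘ₗ LinearMap.mulLeft k (L.ρ L.Φ * L.M (f ⊗ₜ[k] g)) ∘ₗ L.ρ.toLinearMap ∘ₗ Z =
          LinearMap.mulRight k g ∘ₗ (L.κ ∘ₗ LinearMap.mulLeft k ((L.Φ : L.B) * L.δ f) ∘ₗ Z) := by
        ext h
        have : L.ρ L.Φ * L.M (f ⊗ₜ[k] g) * L.ρ (Z h) =
            L.ρ (L.Φ * L.δ f) * L.M ((1 : H) ⊗ₜ[k] g) * L.ρ (Z h) := by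
          rw [map_mul L.ρ, ← M_tmul_one, mul_assoc (L.ρ _) (L.M _) (L.M _), ← map_mul L.M]
          simp
        simp only [LinearMap.comp_apply, LinearMap.mulLeft_apply, LinearMap.mulRight_apply,
          AlgHom.toLinearMap_apply, κ', this, κ_last]
      rw [e₁, e₂]
      exact LinearMap.trace_mul_comm k _ _
  -- By `κ_rotate`, `Φ δ(g)` moves to the right of `Z h`, where `Φ⁻¹ Φ` cancels. Cyclicity moves
  -- left multiplication by `f` before `S`, leaving `S(f) u⁻¹ g`, which sums to `1` over `t = F`.
  have step₂ : ∀ t : H ⊗[k] H,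
      LinearMap.trace k H (κ' ∘ₗ LinearMap.mulLeft k (((1 : H) ⊗ₜ[k] (L.Φ : L.B)) *
        Algebra.TensorProduct.map (AlgHom.id k H) L.δ t) ∘ₗ L.ρ.toLinearMap ∘ₗ Z) =
      LinearMap.trace k H (L.κ ∘ₗ LinearMap.mulRight k (L.δ (antipodeMul (twistEltInv F) t)) ∘ₗ
        L.δ.toLinearMap ∘ₗ HopfAlgebra.antipode k) := by
    intro t
    induction t with
    | zero => simp
    | add t t' ht ht' =>
      simp only [map_add, mul_add, left_add, right_add, LinearMap.add_comp, LinearMap.comp_add,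
        ht, ht']
    | tmul f g =>
      have e₁ : κ' ∘ₗ LinearMap.mulLeft k (((1 : H) ⊗ₜ[k] (L.Φ : L.B)) *
            Algebra.TensorProduct.map (AlgHom.id k H) L.δ (f ⊗ₜ[k] g)) ∘ₗ L.ρ.toLinearMap ∘ₗ Z =
          LinearMap.mulLeft k f ∘ₗ (L.κ ∘ₗ LinearMap.mulRight k (L.δ (twistEltInv F * g)) ∘ₗ
            L.δ.toLinearMap ∘ₗ HopfAlgebra.antipode k) := by
        ext h
        have : ((1 : H) ⊗ₜ[k] (L.Φ : L.B)) * Algebra.TensorProduct.map (AlgHom.id k H) L.δ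
            (f ⊗ₜ[k] g) * L.ρ (Z h) =
            (f ⊗ₜ[k] 1) * (((1 : H) ⊗ₜ[k] ((L.Φ : L.B) * L.δ g)) * L.ρ (Z h)) := by
          rw [← mul_assoc]; simp
        simp only [LinearMap.comp_apply, LinearMap.mulLeft_apply, LinearMap.mulRight_apply,
          AlgHom.toLinearMap_apply, κ', this, mul_lTensor_tmul_mul, κ_rotate]
        simp [Z, W, mul_assoc]
      have e₂ : L.κ ∘ₗ LinearMap.mulRight k (L.δ (antipodeMul (twistEltInv F) (f ⊗ₜ[k] g))) ∘ₗ
            L.δ.toLinearMap ∘ₗ HopfAlgebra.antipode k =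
          (L.κ ∘ₗ LinearMap.mulRight k (L.δ (twistEltInv F * g)) ∘ₗ
            L.δ.toLinearMap ∘ₗ HopfAlgebra.antipode k) ∘ₗ LinearMap.mulLeft k f := by
        ext h
        simp [HopfAlgebra.antipode_mul_antidistrib, mul_assoc]
      rw [e₁, e₂]
      exact LinearMap.trace_mul_comm k _ _
  have h₁ := step₁ (F : H ⊗[k] H)
  rw [← M_twist, step₂, antipodeMul_twistEltInv, map_one, LinearMap.mulRight_one,
    LinearMap.id_comp] at h₁
  rw [← h₁]
  congr 1
  ext h
  simp [Z, W, twistElt, mul_assoc]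

end IteratedTwist

/-! ### Equality of the indicator sequences. -/

section GaugeInvariance

variable {k : Type*} [Field k] {H : Type*} [Ring H] [HopfAlgebra k H] [FiniteDimensional k H]
  {H' : Type*} [Ring H'] [HopfAlgebra k H'] {F : (H ⊗[k] H)ˣ}

theorem IsTwistEquiv.indicatorSeq_eq {φ : H' ≃ₐ[k] H} (hφ : IsTwistEquiv F φ)
    (hF : IsTwoCocycle F) : indicatorSeq k H = indicatorSeq k H' := by
  have : FiniteDimensional k H' := Module.Finite.equiv φ.symm.toLinearEquiv
  funext n
  simp only [indicatorSeq, indicator, Nat.add_sub_cancel]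
  rw [LinearMap.trace_comp_comm', LinearMap.trace_comp_comm' (sweedlerPower k H' n),
    ← LinearMap.trace_conj' _ φ.toLinearEquiv]
  -- `P_0` is the counit term and involves no tensor power, so it is separate; `iter hF n` handles
  -- `P_{n+1}`.
  cases n with
  | zero =>
    congr 1
    ext h
    simp [LinearEquiv.conj_apply, sweedlerPower, ← hφ.counit (φ.symm h)]
  | succ n =>
    have e₁ : sweedlerPower k H (n + 1) ∘ₗ HopfAlgebra.antipode k =
        (IteratedTwist.iter hF n).κ ∘ₗ (IteratedTwist.iter hF n).δ.toLinearMap ∘ₗ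
          HopfAlgebra.antipode k := by
      ext h
      exact (IteratedTwist.κ_δ hF n _).symm
    rw [e₁, ← IteratedTwist.trace_twist]
    congr 1
    ext h
    have := IteratedTwist.κ_twist hφ hF n (HopfAlgebra.antipode k (φ.symm h))
    rw [hφ.antipode hF, AlgEquiv.apply_symm_apply] at this
    simp only [LinearEquiv.conj_apply, LinearMap.comp_apply]
    refine Eq.trans ?_ this.symm
    simp [mul_assoc]

end GaugeInvariance

end HopfIndicator

end

theorem proposition2p6 (k : Type u) [Field k] (H : Type v) [Ring H] [HopfAlgebra k H]
    [FiniteDimensional k H] :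
    LinRec.IsLinearlyRecursive (HopfIndicator.indicatorSeq k H) ∧
    (HopfIndicator.indicatorPolynomial k H).natDegree ≤ (Module.finrank k H) ^ 2 ∧
    ∀ (H' : Type w) [Ring H'] [HopfAlgebra k H'],
      HopfIndicator.GaugeEquivalent k H H' →
        HopfIndicator.indicatorPolynomial k H = HopfIndicator.indicatorPolynomial k H' := by
  refine ⟨HopfIndicator.isLinearlyRecursive_indicatorSeq k H,
    HopfIndicator.natDegree_indicatorPolynomial_le k H, fun H' _ _ ⟨F, hF, ⟨e⟩⟩ => ?_⟩
  obtain ⟨φ, hφ⟩ := HopfIndicator.exists_isTwistEquiv e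
  rw [HopfIndicator.indicatorPolynomial, HopfIndicator.indicatorPolynomial, hφ.indicatorSeq_eq hF]
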